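/- Let $A=(a_{ij})_{i,j\in\mathcal I}$ be an indecomposable generalized Cartan matrix with finite index set $\mathcal I$, let $(\mathfrak h,\{\alpha_i\}_{i\in\mathcal I},\{\alpha_i^\vee\}_{i\in\mathcal I})$ be a realization of $A$ over $\mathbb C$, and let $\mathfrak g=\mathfrak g(A)$ be the corresponding Kac–Moody algebra. That is, $\mathfrak g(A)$ is the quotient of the complex Lie algebra $\tilde{\mathfrak g}(A)$ generated by the vector space $\mathfrak h$ and elements $e_i,f_i$ $(i\in\mathcal I)$, with relations $$[h,h']=0,\quad [e_i,f_j]=\delta_{ij}\alpha_i^\vee,\quad [h,e_i]=\alpha_i(h)e_i,\quad [h,f_i]=-\alpha_i(h)f_i\qquad(h,h'\in\mathfrak h,\ i,j\in\mathcal I),$$ by its largest ideal intersecting $\mathfrak h$ trivially. For $\beta\in\mathbb Z\Pi=\bigoplus_{i\in\mathcal I}\mathbb Z\alpha_i\subset\mathfrak h^*$ let $\mathfrak g_\beta=\{x\in\mathfrak g : [h,x]=\beta(h)x\ \text{for all } h\in\mathfrak h\}$, and let $$\Delta=\{\beta\in\mathbb Z\Pi : \beta\ne 0,\ \mathfrak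 g_\beta\neq 0\},\qquad \Delta^+=\Delta\cap\textstyle\sum_{i}\mathbb Z_{\ge 0}\alpha_i$$ be the sets of roots and of positive roots. Let $\emptyset\neq I\subseteq\mathcal I$. For $\beta=\sum_{i\in\mathcal I}c_i\alpha_i\in\mathbb Z\Pi$ put $\mathrm{ht}_I(\beta)=\sum_{i\in I}c_i$, and let $\Delta_{I,1}=\{\gamma\in\Delta : \mathrm{ht}_I(\gamma)=1\}$. **Theorem 3.6.** Let $\beta\in\Delta^+$ be such that $\mathrm{ht}_I(\beta)<\sup\{\mathrm{ht}_I(\alpha) : \alpha\in\Delta\}$ (the supremum may be $+\infty$), and let $0\neq x\in\mathfrak g_\beta$. Then there exist a root $\gamma\in\Delta_{I,1}$ and a vector $0\ne x_\gamma\in\mathfrak g_\gamma$ such that $[x_\gamma,x]\neq 0$; moreover $\beta+\gamma\in\Delta$ for this $\gamma$. -/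

import Mathlib

namespace KacMoody

noncomputable section

universe u v

/-- A generalized Cartan matrix. -/
structure IsGCM {ι : Type u} (A : Matrix ι ι ℤ) : Prop where
  diag : ∀ i, A i i = 2
  nonpos : ∀ i j, i ≠ j → A i j ≤ 0
  zero_symm : ∀ i j, A i j = 0 → A j i = 0

/-- `A` is indecomposable: the index set is not a disjoint union of two nonempty parts such that all
entries of `A` between the two parts vanish. -/
def IsIndecomposable {ι : Type u} (A : Matrix ι ι ℤ) : Prop :=
  ∀ S : Set ι, S.Nonempty → Sᶜ.Nonempty → ∃ i ∈ S, ∃ j ∈ Sᶜ, A i j ≠ 0 ∨ A j i ≠ 0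

/-- A realization `(𝔥, Π, Π^∨)` over `ℂ` of a square matrix `A`: the simple roots and the simple
coroots are linearly independent in `𝔥*` and `𝔥`, they satisfy `⟨α_j, α_i^∨⟩ = a_{ij}`, and
`n - rank A = dim 𝔥 - n`, where `n` is the size of `A`. -/
structure Realization {ι : Type u} [Fintype ι] (A : Matrix ι ι ℤ)
    (H : Type v) [AddCommGroup H] [Module ℂ H] where
  finite : Module.Finite ℂ H
  simpleRoot : ι → Module.Dual ℂ H
  simpleCoroot : ι → H
  linearIndependent_simpleRoot : LinearIndependent ℂ simpleRoot
  linearIndependent_simpleCoroot : LinearIndependent ℂ simpleCoroot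
  pairing : ∀ i j, simpleRoot j (simpleCoroot i) = (A i j : ℂ)
  finrank_add_rank :
    Module.finrank ℂ H + (A.map (fun a : ℤ => (a : ℂ))).rank = 2 * Fintype.card ι

/-- The generators `e_i`, `f_i` and all elements of `𝔥`. -/
inductive Gen (ι : Type u) (H : Type v) : Type (max u v)
  | e : ι → Gen ι H
  | f : ι → Gen ι H
  | h : H → Gen ι H

section

variable {ι : Type u} {H : Type v} [Fintype ι] [AddCommGroup H] [Module ℂ H]
  {A : Matrix ι ι ℤ} (R : Realization A H)

/-- The free Lie algebra on the generators. -/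
abbrev Free (ι : Type u) (H : Type v) : Type (max u v) := FreeLieAlgebra ℂ (Gen ι H)

def freeE (H : Type v) (i : ι) : Free ι H := FreeLieAlgebra.of ℂ (Gen.e i)

def freeF (H : Type v) (i : ι) : Free ι H := FreeLieAlgebra.of ℂ (Gen.f i)

def freeH (ι : Type u) (a : H) : Free ι H := FreeLieAlgebra.of ℂ (Gen.h a)

/-- The defining relations of the auxiliary Lie algebra `𝔤̃(A)`: the elements `x` of the free Lie
algebra satisfying `Rel R x` are declared to be zero. The first two families say that `𝔥` is
included as a vector space. -/
inductive Rel : Free ι H → Prop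
  | add (a b : H) : Rel (freeH ι (a + b) - (freeH ι a + freeH ι b))
  | smul (c : ℂ) (a : H) : Rel (freeH ι (c • a) - c • freeH ι a)
  | hh (a b : H) : Rel ⁅freeH ι a, freeH ι b⁆
  | ef_same (i : ι) : Rel (⁅freeE H i, freeF H i⁆ - freeH ι (R.simpleCoroot i))
  | ef_ne (i j : ι) (hij : i ≠ j) : Rel ⁅freeE H i, freeF H j⁆
  | he (a : H) (i : ι) : Rel (⁅freeH ι a, freeE H i⁆ - R.simpleRoot i a • freeE H i)
  | hf (a : H) (i : ι) : Rel (⁅freeH ι a, freeF H i⁆ + R.simpleRoot i a • freeF H i)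

/-- The ideal of the free Lie algebra generated by the defining relations. -/
def relIdeal : LieIdeal ℂ (Free ι H) :=
  LieSubmodule.lieSpan ℂ (Free ι H) {x | Rel R x}

/-- The auxiliary Lie algebra `𝔤̃(A)`, by generators and relations. -/
abbrev AuxAlgebra : Type (max u v) := Free ι H ⧸ relIdeal R

/-- The canonical map from the free Lie algebra to `𝔤̃(A)`. -/
def auxMk (x : Free ι H) : AuxAlgebra R := LieSubmodule.Quotient.mk x

/-- The image of `𝔥` in `𝔤̃(A)`. -/
def auxCartan : Set (AuxAlgebra R) :=
  Set.range fun a : H => auxMk R (freeH ι a)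

/-- The maximal ideal `𝔯` of `𝔤̃(A)` among those intersecting `𝔥` trivially, formed as the sum of
all such ideals. -/
def radical : LieIdeal ℂ (AuxAlgebra R) :=
  sSup {J : LieIdeal ℂ (AuxAlgebra R) | ∀ x ∈ J, x ∈ auxCartan R → x = 0}

/-- The Kac--Moody algebra `𝔤(A) = 𝔤̃(A) / 𝔯`. -/
abbrev KMAlgebra : Type (max u v) := AuxAlgebra R ⧸ radical R

/-- The image in `𝔤(A)` of an element of the free Lie algebra. -/
def mk (x : Free ι H) : KMAlgebra R := LieSubmodule.Quotient.mk (auxMk R x)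

/-- The image of `a ∈ 𝔥` in `𝔤(A)`. -/
def cartan (a : H) : KMAlgebra R := mk R (freeH ι a)

/-- The element `∑ c_i α_i` of `𝔥*` with integer coordinates `c`. As the `α_i` are linearly
independent, `ι → ℤ` is in this way identified with the root lattice `Q = ℤΠ ⊆ 𝔥*`. -/
def weight (c : ι → ℤ) : Module.Dual ℂ H := ∑ i, c i • R.simpleRoot i

/-- The space `𝔤_β = {x | [h, x] = β(h) x for all h ∈ 𝔥}`, for `β` in the root lattice. -/
def rootSpace (β : ι → ℤ) : Submodule ℂ (KMAlgebra R) where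
  carrier := {x | ∀ a : H, ⁅cartan R a, x⁆ = weight R β a • x}
  zero_mem' := fun a => by rw [lie_zero, smul_zero]
  add_mem' := fun {x y} hx hy a => by rw [lie_add, hx a, hy a, smul_add]
  smul_mem' := fun c x hx a => by rw [lie_smul, hx a, smul_comm]

/-- The root system `Δ = {β ∈ Q | β ≠ 0, 𝔤_β ≠ 0}`. -/
def roots : Set (ι → ℤ) := {β | β ≠ 0 ∧ rootSpace R β ≠ ⊥}

/-- The positive roots `Δ⁺ = Δ ∩ ℤ_{≥0}Π`. -/
def positiveRoots : Set (ι → ℤ) := {β | β ∈ roots R ∧ ∀ i, 0 ≤ β i}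

/-- The `I`-height `ht_I(∑ c_i α_i) = ∑_{i ∈ I} c_i`. -/
def height (I : Finset ι) (β : ι → ℤ) : ℤ := ∑ i ∈ I, β i

/-- The set `Δ_{I,n}` of the roots of `I`-height `n`. -/
def rootsOfHeight (I : Finset ι) (n : ℤ) : Set (ι → ℤ) := {β | β ∈ roots R ∧ height I β = n}

end

end

end KacMoody

/-! Suppose `x` is killed by every weight vector of `I`-height one. Grade 𝔤 by `I`-height, let `M`
be the space of vectors of degree ht_I(β) killed by all weight vectors of height one, and close `M`
under bracketing with those of height -1. By the Leibniz rule the closure `J` is also stable under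
weight vectors of heights 0 and 1. The Chevalley generators all have height 0 or ±1, so `J` is an
ideal, and it contains `x` and lives in heights at most ht_I(β) (`height_le_of_forall_lie_eq_zero`).

On the other hand `J` is large. Lowering `x` by suitable f_i inside `J` reaches a nonzero vector of
principal degree one, hence some e_i (`exists_e_mem`); indecomposability then gives all e_j and f_j,
hence every root vector. So no root has `I`-height above ht_I(β), against the assumption on the
supremum.

The lowering never meets zero too early because a vector of positive degree killed by all f_i
generates, by the same closure construction, an ideal in positive degrees; such an ideal misses 𝔥
and so vanishes (`exists_f_lie_ne_zero`). That 𝔤 has no nonzero ideal missing 𝔥 rests on the zero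
eigenspace of a principal grading element being exactly 𝔥. -/

namespace KacMoody

noncomputable section

universe u v w

/-! ### Ideals obtained by closing a subspace under brackets -/

section LieGeneral

variable {L : Type w} [LieRing L] [LieAlgebra ℂ L]

/-- The elements of a Lie algebra mapping a subspace into itself. -/
def stabilizer (V : Submodule ℂ L) : LieSubalgebra ℂ L where
  carrier := {x | ∀ z ∈ V, ⁅x, z⁆ ∈ V}
  zero_mem' := fun z _ => by simp
  add_mem' := fun {x y} hx hy z hz => by
    rw [add_lie]; exact V.add_mem (hx z hz) (hy z hz)
  smul_mem' := fun c x hx z hz => by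
    rw [smul_lie]; exact V.smul_mem c (hx z hz)
  lie_mem' := fun {x y} hx hy z hz => by
    rw [lie_lie]; exact V.sub_mem (hx _ (hy z hz)) (hy _ (hx z hz))

theorem mem_stabilizer_iff_le_comap {V : Submodule ℂ L} {x : L} :
    x ∈ stabilizer V ↔ V ≤ V.comap (LieAlgebra.ad ℂ L x) := Iff.rfl

/-- A subspace stabilized by the whole Lie algebra, as an ideal. -/
def idealOfStable (V : Submodule ℂ L) (hV : stabilizer V = ⊤) : LieIdeal ℂ L :=
  { V with
    lie_mem := fun {x z} hz => by
      have hx : x ∈ stabilizer V := by rw [hV]; trivial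
      exact hx z hz }

/-- The elements `z` such that `⁅y, z⁆ ∈ C` for all `y ∈ S`. -/
def transporter (S : Set L) (C : Submodule ℂ L) : Submodule ℂ L where
  carrier := {z | ∀ y ∈ S, ⁅y, z⁆ ∈ C}
  zero_mem' := fun y _ => by simp
  add_mem' := fun {x z} hx hz y hy => by
    rw [lie_add]; exact C.add_mem (hx y hy) (hz y hy)
  smul_mem' := fun c x hx y hy => by
    rw [lie_smul]; exact C.smul_mem c (hx y hy)

/-- The smallest subspace containing `M` and closed under bracketing with `T`. -/
def adClosure (T : Set L) (M : Submodule ℂ L) : Submodule ℂ L :=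
  sInf {N | M ≤ N ∧ N ≤ transporter T N}

theorem le_adClosure (T : Set L) (M : Submodule ℂ L) : M ≤ adClosure T M :=
  le_sInf fun _ hN => hN.1

theorem adClosure_le {T : Set L} {M N : Submodule ℂ L} (h : M ≤ N) (h' : N ≤ transporter T N) :
    adClosure T M ≤ N :=
  sInf_le ⟨h, h'⟩

theorem adClosure_le_transporter (T : Set L) (M : Submodule ℂ L) :
    adClosure T M ≤ transporter T (adClosure T M) := by
  intro z hz y hy
  refine Submodule.mem_sInf.2 fun N hN => hN.2 (Submodule.mem_sInf.1 hz N hN) y hy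

/-- The z in the closure with ⁅y, z⁆ in the closure for all y ∈ S form a subspace containing `M`,
closed under `T` since ⁅y, ⁅t, z⁆⁆ = ⁅⁅y, t⁆, z⁆ + ⁅t, ⁅y, z⁆⁆. -/
theorem adClosure_le_transporter_of_normalizes {T S : Set L} {M : Submodule ℂ L}
    (hM : M ≤ transporter S (adClosure T M))
    (hST : ∀ y ∈ S, ∀ t ∈ T, ∀ z ∈ adClosure T M, ⁅⁅y, t⁆, z⁆ ∈ adClosure T M) :
    adClosure T M ≤ transporter S (adClosure T M) := by
  suffices h : adClosure T M ≤ adClosure T M ⊓ transporter S (adClosure T M) from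
    h.trans inf_le_right
  refine adClosure_le (le_inf (le_adClosure T M) hM) ?_
  rintro z ⟨hz, hz'⟩ t ht
  refine ⟨adClosure_le_transporter T M hz t ht, fun y hy => ?_⟩
  rw [leibniz_lie]
  exact Submodule.add_mem _ (hST y hy t ht z hz)
    (adClosure_le_transporter T M (hz' y hy) t ht)

/-- If `S₀` preserves `M` and `T`, `S₁` annihilates `M`, and `⁅S₁, T⁆ ⊆ S₀`, then the closure of
`M` under `T` is stable under `S₀`, `S₁` and `T`. -/
theorem le_stabilizer_adClosure {S₀ S₁ T : Set L} {M : Submodule ℂ L}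
    (h₀M : ∀ y ∈ S₀, ∀ z ∈ M, ⁅y, z⁆ ∈ M) (h₁M : ∀ y ∈ S₁, ∀ z ∈ M, ⁅y, z⁆ = 0)
    (h₀T : ∀ y ∈ S₀, ∀ t ∈ T, ⁅y, t⁆ ∈ T) (h₁T : ∀ y ∈ S₁, ∀ t ∈ T, ⁅y, t⁆ ∈ S₀) :
    S₀ ∪ S₁ ∪ T ⊆ stabilizer (adClosure T M) := by
  have h₀ : adClosure T M ≤ transporter S₀ (adClosure T M) :=
    adClosure_le_transporter_of_normalizes
      (fun z hz y hy => le_adClosure T M (h₀M y hy z hz))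
      fun y hy t ht z hz => adClosure_le_transporter T M hz _ (h₀T y hy t ht)
  have h₁ : adClosure T M ≤ transporter S₁ (adClosure T M) :=
    adClosure_le_transporter_of_normalizes
      (fun z hz y hy => by rw [h₁M y hy z hz]; exact Submodule.zero_mem _)
      fun y hy t ht z hz => h₀ hz _ (h₁T y hy t ht)
  refine Set.union_subset (Set.union_subset ?_ ?_) ?_
  · exact fun y hy z hz => h₀ hz y hy
  · exact fun y hy z hz => h₁ hz y hy
  · exact fun y hy z hz => adClosure_le_transporter T M hz y hy

end LieGeneral

/-! ### Eigenspace decompositions and invariant subspaces -/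

section LinearGeneral

variable {V : Type w} [AddCommGroup V] [Module ℂ V]

/-- The components of an element of an invariant subspace in the eigenspaces lie in the
subspace. -/
theorem mem_of_sum_eigenvectors_mem (f : Module.End ℂ V) {p : Submodule ℂ V}
    (hp : ∀ x ∈ p, f x ∈ p) (s : Finset ℂ) :
    ∀ m : ℂ → V, (∀ μ, m μ ∈ f.eigenspace μ) → ∑ μ ∈ s, m μ ∈ p → ∀ μ ∈ s, m μ ∈ p := by
  classical
  induction s using Finset.induction_on with
  | empty => simp
  | insert a s ha ih =>
    intro m hm hs
    have key : ∀ μ ∈ s, m μ ∈ p := by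
      intro μ hμ
      -- Applying f - a removes the `a`-component and rescales the others by nonzero factors.
      have h1 : ∑ μ ∈ s, (μ - a) • m μ ∈ p := by
        have h2 := p.sub_mem (hp _ hs) (p.smul_mem a hs)
        rw [map_sum, Finset.smul_sum, ← Finset.sum_sub_distrib, Finset.sum_insert ha] at h2
        simpa only [Module.End.mem_eigenspace_iff.1 (hm _), ← sub_smul, sub_self, zero_smul,
          zero_add] using h2
      have h3 := ih (fun μ => (μ - a) • m μ)
        (fun μ => Submodule.smul_mem _ _ (hm μ)) h1 μ hμ
      have hne : μ - a ≠ 0 := sub_ne_zero.2 fun h => ha (h ▸ hμ)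
      exact (Submodule.smul_mem_iff p hne).1 h3
    intro μ hμ
    rcases Finset.mem_insert.1 hμ with rfl | hμ
    · rw [Finset.sum_insert ha] at hs
      exact (Submodule.add_mem_iff_left p (Submodule.sum_mem p key)).1 hs
    · exact key μ hμ

/-- An invariant subspace meeting an eigenspace trivially lies in the sum of the others, provided
the eigenspaces span. -/
theorem le_iSup_eigenspace_ne (f : Module.End ℂ V) (hf : ⨆ μ, f.eigenspace μ = ⊤)
    {p : Submodule ℂ V} (hp : ∀ x ∈ p, f x ∈ p) (a : ℂ) (ha : ∀ x ∈ p, x ∈ f.eigenspace a → x = 0) :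
    p ≤ ⨆ μ, ⨆ (_ : μ ≠ a), f.eigenspace μ := by
  intro x hx
  have hx' : x ∈ ⨆ μ, f.eigenspace μ := by rw [hf]; trivial
  obtain ⟨m, hm, rfl⟩ := (Submodule.mem_iSup_iff_exists_finsupp _ _).1 hx'
  have h := mem_of_sum_eigenvectors_mem f hp m.support m hm hx
  refine Submodule.sum_mem _ fun μ hμ => ?_
  have hne : μ ≠ a := by
    rintro rfl
    exact (Finsupp.mem_support_iff.1 hμ) (ha _ (h _ hμ) (hm _))
  exact Submodule.mem_iSup_of_mem μ (Submodule.mem_iSup_of_mem hne (hm μ))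

/-- By the modular law, E n is Q n plus its intersection with the sum of the other E m, which is
zero. -/
theorem le_of_iSupIndep_of_iSup_eq_top {κ : Type*} {E Q : κ → Submodule ℂ V} (hE : iSupIndep E)
    (hQ : ∀ n, Q n ≤ E n) (h : ⨆ n, Q n = ⊤) (n : κ) : E n ≤ Q n := by
  have h1 : Q n ⊔ ⨆ (m) (_ : m ≠ n), E m = ⊤ := by
    rw [eq_top_iff, ← h]
    refine iSup_le fun m => ?_
    by_cases hm : m = n
    · subst hm; exact le_sup_left
    · exact le_sup_of_le_right (le_iSup₂_of_le m hm (hQ m))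
  calc E n = (Q n ⊔ ⨆ (m) (_ : m ≠ n), E m) ⊓ E n := by rw [h1, top_inf_eq]
    _ = Q n ⊔ (⨆ (m) (_ : m ≠ n), E m) ⊓ E n := sup_inf_assoc_of_le _ (hQ n)
    _ ≤ Q n := by rw [(hE n).symm.eq_bot, sup_bot_eq]

end LinearGeneral

/-! ### Chevalley generators, the principal grading, and ideals missing 𝔥 -/

section Gens

variable {ι : Type u} {H : Type v} [Fintype ι] [AddCommGroup H] [Module ℂ H]
  {A : Matrix ι ι ℤ} {R : Realization A H} {L : Type w} [LieRing L] [LieAlgebra ℂ L]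

/-- Elements of `𝔥` with prescribed values of the simple roots. -/
theorem Realization.exists_simpleRoot_eq (R : Realization A H) (t : ι → ℂ) :
    ∃ a : H, ∀ i, R.simpleRoot i a = t i := by
  classical
  have hs : Function.Surjective (LinearMap.pi R.simpleRoot) := by
    rw [← LinearMap.dualMap_injective_iff, injective_iff_map_eq_zero]
    intro φ hφ
    have h1 : ∑ i, φ (Pi.single i 1) • R.simpleRoot i = 0 := by
      ext a
      have h2 := LinearMap.congr_fun hφ a
      rw [LinearMap.dualMap_apply, ← LinearMap.sum_single_apply (fun _ => ℂ)
        (LinearMap.pi R.simpleRoot a), map_sum] at h2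
      simp only [LinearMap.coe_sum, Finset.sum_apply, LinearMap.smul_apply, smul_eq_mul]
      rw [LinearMap.zero_apply] at h2 ⊢
      rw [← h2]
      refine Finset.sum_congr rfl fun i _ => ?_
      have h3 : Pi.single i (LinearMap.pi R.simpleRoot a i) =
          R.simpleRoot i a • (Pi.single i 1 : ι → ℂ) := by
        rw [← Pi.single_smul, smul_eq_mul, mul_one]; rfl
      rw [h3, map_smul]
      exact mul_comm _ _
    have h3 := Fintype.linearIndependent_iff.1 R.linearIndependent_simpleRoot _ h1
    refine LinearMap.pi_ext fun i c => ?_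
    have h4 : Pi.single i c = c • (Pi.single i 1 : ι → ℂ) := by
      rw [← Pi.single_smul, smul_eq_mul, mul_one]
    rw [h4, map_smul, h3 i, smul_zero, LinearMap.zero_apply]
  obtain ⟨a, ha⟩ := hs t
  exact ⟨a, fun i => congrFun ha i⟩

variable (R L) in
/-- A Lie algebra generated by elements satisfying the defining relations of `𝔤̃(A)`. -/
structure ChevalleyGens where
  e : ι → L
  f : ι → L
  h : H →ₗ[ℂ] L
  h_h : ∀ a b, ⁅h a, h b⁆ = 0
  e_f_same : ∀ i, ⁅e i, f i⁆ = h (R.simpleCoroot i)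
  e_f_ne : ∀ i j, i ≠ j → ⁅e i, f j⁆ = 0
  h_e : ∀ a i, ⁅h a, e i⁆ = R.simpleRoot i a • e i
  h_f : ∀ a i, ⁅h a, f i⁆ = -(R.simpleRoot i a • f i)
  eq_top : ∀ K : LieSubalgebra ℂ L, (∀ i, e i ∈ K) → (∀ i, f i ∈ K) → (∀ a, h a ∈ K) → K = ⊤

namespace ChevalleyGens

variable (D : ChevalleyGens R L)

/-- The Chevalley involution, as a change of generators. -/
def swap : ChevalleyGens R L where
  e := D.f
  f := D.e
  h := -D.h
  h_h := fun a b => by simp [D.h_h]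
  e_f_same := fun i => by rw [← lie_skew, D.e_f_same]; rfl
  e_f_ne := fun i j hij => by rw [← lie_skew, D.e_f_ne j i hij.symm, neg_zero]
  h_e := fun a i => by rw [LinearMap.neg_apply, neg_lie, D.h_f, neg_neg]
  h_f := fun a i => by rw [LinearMap.neg_apply, neg_lie, D.h_e]
  eq_top := fun K he hf hh => D.eq_top K hf he fun a => by
    have := K.neg_mem_iff.1 (hh a)
    exact this

theorem swap_swap : D.swap.swap = D := by
  cases D
  simp [swap]

theorem e_f_mem_range (i j : ι) : ⁅D.e i, D.f j⁆ ∈ LinearMap.range D.h := by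
  by_cases hij : i = j
  · subst hij; exact ⟨_, (D.e_f_same i).symm⟩
  · rw [D.e_f_ne i j hij]; exact Submodule.zero_mem _

theorem f_e_mem_range (i j : ι) : ⁅D.f i, D.e j⁆ ∈ LinearMap.range D.h := by
  rw [← lie_skew]; exact Submodule.neg_mem _ (D.e_f_mem_range j i)

theorem e_h (i : ι) (a : H) : ⁅D.e i, D.h a⁆ = -(R.simpleRoot i a • D.e i) := by
  rw [← lie_skew, D.h_e]

theorem f_h (i : ι) (a : H) : ⁅D.f i, D.h a⁆ = R.simpleRoot i a • D.f i := by
  rw [← lie_skew, D.h_f, neg_neg]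

/-- The eigenspaces of `ad h` for `h ∈ 𝔥`. -/
def eig (a : H) (μ : ℂ) : Submodule ℂ L := (LieAlgebra.ad ℂ L (D.h a)).eigenspace μ

theorem mem_eig {a : H} {μ : ℂ} {z : L} : z ∈ D.eig a μ ↔ ⁅D.h a, z⁆ = μ • z := by
  rw [eig, Module.End.mem_eigenspace_iff, LieAlgebra.ad_apply]

theorem lie_mem_eig {a : H} {μ ν : ℂ} {y z : L} (hy : y ∈ D.eig a μ) (hz : z ∈ D.eig a ν) :
    ⁅y, z⁆ ∈ D.eig a (μ + ν) := by
  rw [mem_eig] at *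
  rw [leibniz_lie, hy, hz, smul_lie, lie_smul, add_smul]

theorem e_mem_eig (a : H) (i : ι) : D.e i ∈ D.eig a (R.simpleRoot i a) := D.mem_eig.2 (D.h_e a i)

theorem f_mem_eig (a : H) (i : ι) : D.f i ∈ D.eig a (-R.simpleRoot i a) := by
  rw [mem_eig, D.h_f, neg_smul]

theorem h_mem_eig (a b : H) : D.h b ∈ D.eig a 0 := by
  rw [mem_eig, D.h_h, zero_smul]

theorem swap_eig (a : H) (μ : ℂ) : D.swap.eig a μ = D.eig a (-μ) := by
  ext z
  rw [mem_eig, mem_eig, neg_smul]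
  change ⁅-D.h a, z⁆ = _ ↔ _
  rw [neg_lie, neg_eq_iff_eq_neg]

/-- Independence of the eigenspaces, for one eigenvalue and a set of other ones. -/
theorem eq_zero_of_mem_eig {a : H} {μ : ℂ} {S : Set ℂ} (hμ : μ ∉ S) {z : L} (hz : z ∈ D.eig a μ)
    (hz' : z ∈ ⨆ ν ∈ S, D.eig a ν) : z = 0 :=
  (Submodule.disjoint_def.1 ((LieAlgebra.ad ℂ L (D.h a)).eigenspaces_iSupIndep.disjoint_biSup hμ))
    z hz hz'

/-- `𝔥` for `k = 0`, and the span of the iterated brackets of `k` of the `e_i` for `k > 0`. -/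
def posPart : ℕ → Submodule ℂ L
  | 0 => LinearMap.range D.h
  | k + 1 => ⨆ i, (posPart k).map (LieAlgebra.ad ℂ L (D.e i))

theorem e_lie_mem_posPart (i : ι) {k : ℕ} {z : L} (hz : z ∈ D.posPart k) :
    ⁅D.e i, z⁆ ∈ D.posPart (k + 1) :=
  Submodule.mem_iSup_of_mem i ⟨z, hz, rfl⟩

theorem posPart_succ_le {k : ℕ} {N : Submodule ℂ L}
    (h : ∀ i, ∀ z ∈ D.posPart k, ⁅D.e i, z⁆ ∈ N) : D.posPart (k + 1) ≤ N := by
  refine iSup_le fun i => ?_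
  rintro _ ⟨z, hz, rfl⟩
  exact h i z hz

theorem h_lie_mem_posPart (a : H) (k : ℕ) : D.h a ∈ stabilizer (D.posPart k) := by
  induction k with
  | zero =>
    rintro _ ⟨b, rfl⟩
    rw [D.h_h]; exact Submodule.zero_mem _
  | succ k ih =>
    change D.posPart (k + 1) ≤ (D.posPart (k + 1)).comap (LieAlgebra.ad ℂ L (D.h a))
    refine D.posPart_succ_le fun i z hz => ?_
    change ⁅D.h a, ⁅D.e i, z⁆⁆ ∈ D.posPart (k + 1)
    rw [leibniz_lie, D.h_e, smul_lie]
    exact Submodule.add_mem _ (Submodule.smul_mem _ _ (D.e_lie_mem_posPart i hz))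
      (D.e_lie_mem_posPart i (ih z hz))

theorem range_lie_mem_posPart {y z : L} {k : ℕ} (hy : y ∈ LinearMap.range D.h)
    (hz : z ∈ D.posPart k) : ⁅y, z⁆ ∈ D.posPart k := by
  obtain ⟨a, rfl⟩ := hy
  exact D.h_lie_mem_posPart a k z hz

/-- Starting the recursion of `posPart` at 𝔥 makes this uniform down to degree zero, where ⁅f_j,
e_i⁆ lands. -/
theorem f_lie_mem_posPart (j : ι) {k : ℕ} :
    ∀ z ∈ D.posPart (k + 1), ⁅D.f j, z⁆ ∈ D.posPart k := by
  induction k with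
  | zero =>
    change D.posPart 1 ≤ (D.posPart 0).comap (LieAlgebra.ad ℂ L (D.f j))
    refine D.posPart_succ_le fun i z hz => ?_
    obtain ⟨a, rfl⟩ := hz
    change ⁅D.f j, ⁅D.e i, D.h a⁆⁆ ∈ LinearMap.range D.h
    rw [D.e_h, lie_neg, lie_smul]
    exact Submodule.neg_mem _ (Submodule.smul_mem _ _ (D.f_e_mem_range j i))
  | succ k ih =>
    change D.posPart (k + 2) ≤
      (D.posPart (k + 1)).comap (LieAlgebra.ad ℂ L (D.f j))
    refine D.posPart_succ_le fun i z hz => ?_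
    change ⁅D.f j, ⁅D.e i, z⁆⁆ ∈ D.posPart (k + 1)
    rw [leibniz_lie]
    exact Submodule.add_mem _ (D.range_lie_mem_posPart (D.f_e_mem_range j i) hz)
      (D.e_lie_mem_posPart i (ih z hz))

theorem posPart_le_eig {ρ : H} (hρ : ∀ i, R.simpleRoot i ρ = 1) (k : ℕ) :
    D.posPart k ≤ D.eig ρ k := by
  induction k with
  | zero =>
    rintro _ ⟨a, rfl⟩
    rw [Nat.cast_zero]
    exact D.h_mem_eig ρ a
  | succ k ih =>
    refine D.posPart_succ_le fun i z hz => ?_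
    have := D.lie_mem_eig (D.e_mem_eig ρ i) (ih hz)
    rwa [hρ, add_comm, ← Nat.cast_succ] at this

theorem e_mem_posPart (i : ι) : D.e i ∈ D.posPart 1 := by
  obtain ⟨a, ha⟩ := R.exists_simpleRoot_eq fun _ => 1
  have h := D.e_lie_mem_posPart i (k := 0) (z := D.h a) ⟨a, rfl⟩
  rw [D.e_h, ha, one_smul] at h
  exact (Submodule.neg_mem_iff _).1 h

theorem posPart_one_le : D.posPart 1 ≤ Submodule.span ℂ (Set.range D.e) := by
  refine D.posPart_succ_le fun i z hz => ?_
  obtain ⟨a, rfl⟩ := hz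
  rw [D.e_h]
  exact Submodule.neg_mem _ (Submodule.smul_mem _ _ (Submodule.subset_span ⟨i, rfl⟩))

theorem swap_posPart_zero : D.swap.posPart 0 = D.posPart 0 :=
  LinearMap.range_neg D.h

theorem e_mem_stabilizer (i : ι) :
    D.e i ∈ stabilizer ((⨆ k, D.posPart k) ⊔ ⨆ k, D.swap.posPart k) := by
  rw [mem_stabilizer_iff_le_comap]
  refine sup_le (iSup_le fun k z hz => ?_) (iSup_le fun k z hz => ?_)
  · exact Submodule.mem_sup_left (Submodule.mem_iSup_of_mem (k + 1) (D.e_lie_mem_posPart i hz))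
  · cases k with
    | zero =>
      rw [swap_posPart_zero] at hz
      exact Submodule.mem_sup_left (Submodule.mem_iSup_of_mem 1 (D.e_lie_mem_posPart i hz))
    | succ k =>
      exact Submodule.mem_sup_right (Submodule.mem_iSup_of_mem k (D.swap.f_lie_mem_posPart i z hz))

/-- The sum is stable under all generators, so it is an ideal; it also contains them. -/
theorem iSup_posPart_sup_iSup : (⨆ k, D.posPart k) ⊔ ⨆ k, D.swap.posPart k = ⊤ := by
  set V := (⨆ k, D.posPart k) ⊔ ⨆ k, D.swap.posPart k with hV
  have hst : stabilizer V = ⊤ := by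
    refine D.eq_top _ D.e_mem_stabilizer (fun i => ?_) fun a => ?_
    · have := D.swap.e_mem_stabilizer i
      rwa [swap_swap, sup_comm] at this
    · rw [mem_stabilizer_iff_le_comap]
      refine sup_le (iSup_le fun k z hz => ?_) (iSup_le fun k z hz => ?_)
      · exact Submodule.mem_sup_left (Submodule.mem_iSup_of_mem k (D.h_lie_mem_posPart a k z hz))
      · refine Submodule.mem_sup_right (Submodule.mem_iSup_of_mem k ?_)
        exact D.swap.range_lie_mem_posPart (LinearMap.range_neg D.h ▸ ⟨a, rfl⟩) hz
  have hK := D.eq_top (idealOfStable V hst).toLieSubalgebra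
    (fun i => Submodule.mem_sup_left (Submodule.mem_iSup_of_mem 1 (D.e_mem_posPart i)))
    (fun i => Submodule.mem_sup_right (Submodule.mem_iSup_of_mem 1 (D.swap.e_mem_posPart i)))
    (fun a => Submodule.mem_sup_left (Submodule.mem_iSup_of_mem 0 ⟨a, rfl⟩))
  rw [eq_top_iff]
  intro x _
  have hx : x ∈ (idealOfStable V hst).toLieSubalgebra := by rw [hK]; trivial
  exact hx

theorem swap_posPart_le_eig {ρ : H} (hρ : ∀ i, R.simpleRoot i ρ = 1) (k : ℕ) :
    D.swap.posPart k ≤ D.eig ρ (-k) := by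
  rw [← swap_eig]; exact D.swap.posPart_le_eig hρ k

theorem iSup_eig_eq_top {ρ : H} (hρ : ∀ i, R.simpleRoot i ρ = 1) : ⨆ μ, D.eig ρ μ = ⊤ := by
  rw [eq_top_iff, ← D.iSup_posPart_sup_iSup]
  exact sup_le (iSup_le fun k => le_iSup_of_le _ (D.posPart_le_eig hρ k))
    (iSup_le fun k => le_iSup_of_le _ (D.swap_posPart_le_eig hρ k))

/-- The graded pieces span and lie in independent eigenspaces, so they exhaust them. For k = 0 this
identifies the zero eigenspace with 𝔥. -/
theorem eig_natCast_le {ρ : H} (hρ : ∀ i, R.simpleRoot i ρ = 1) (k : ℕ) :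
    D.eig ρ k ≤ D.posPart k := by
  let Q : ℤ → Submodule ℂ L := fun n => if 0 ≤ n then D.posPart n.toNat
    else D.swap.posPart (-n).toNat
  have hE : iSupIndep fun n : ℤ => D.eig ρ n :=
    (LieAlgebra.ad ℂ L (D.h ρ)).eigenspaces_iSupIndep.comp Int.cast_injective
  have hQ : ∀ n, Q n ≤ D.eig ρ n := by
    intro n
    dsimp only [Q]
    split_ifs with hn
    · lift n to ℕ using hn
      simpa using D.posPart_le_eig hρ n
    · obtain ⟨m, rfl⟩ : ∃ m : ℕ, n = -m := ⟨(-n).toNat, by omega⟩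
      simpa using D.swap_posPart_le_eig hρ m
  have htop : ⨆ n, Q n = ⊤ := by
    rw [eq_top_iff, ← D.iSup_posPart_sup_iSup]
    refine sup_le (iSup_le fun k => le_iSup_of_le (k : ℤ) ?_)
      (iSup_le fun k => le_iSup_of_le (-k : ℤ) ?_)
    · simp [Q]
    · cases k with
      | zero => simp [Q, swap_posPart_zero]
      | succ k =>
        have : ¬ (0 : ℤ) ≤ -((k + 1 : ℕ) : ℤ) := by omega
        simp only [Q, if_neg this]
        simp
  have := le_of_iSupIndep_of_iSup_eq_top hE hQ htop (k : ℤ)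
  simpa [Q] using this

theorem ideal_le_iSup_eig {ρ : H} (hρ : ∀ i, R.simpleRoot i ρ = 1) (J : LieIdeal ℂ L)
    (hJ : ∀ x ∈ J, x ∈ LinearMap.range D.h → x = 0) :
    J.toSubmodule ≤ ⨆ μ, ⨆ (_ : μ ≠ 0), D.eig ρ μ := by
  refine le_iSup_eigenspace_ne _ (D.iSup_eig_eq_top hρ) (fun x hx => J.lie_mem hx) 0 fun x hx hx' => ?_
  refine hJ x hx ?_
  have := D.eig_natCast_le hρ 0
  rw [Nat.cast_zero] at this
  exact this hx'

/-- The sum of the ideals that intersect `𝔥` trivially intersects `𝔥` trivially. -/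
theorem eq_zero_of_mem_sSup {x : L}
    (hx : x ∈ sSup {J : LieIdeal ℂ L | ∀ x ∈ J, x ∈ LinearMap.range D.h → x = 0})
    (hx' : x ∈ LinearMap.range D.h) : x = 0 := by
  obtain ⟨ρ, hρ⟩ := R.exists_simpleRoot_eq fun _ => 1
  obtain ⟨a, rfl⟩ := hx'
  refine D.eq_zero_of_mem_eig (S := {μ | μ ≠ 0}) (fun h => h rfl) (D.h_mem_eig ρ a) ?_
  rw [← LieSubmodule.mem_toSubmodule, LieSubmodule.sSup_toSubmodule] at hx
  refine (sSup_le ?_ : _ ≤ ⨆ μ, ⨆ (_ : μ ≠ 0), D.eig ρ μ) hx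
  rintro _ ⟨J, hJ, rfl⟩
  exact D.ideal_le_iSup_eig hρ J hJ

end ChevalleyGens

end Gens

/-! ### Heights, weights and the ideal argument -/

section Height

variable {ι : Type u}

theorem height_add (I : Finset ι) (c d : ι → ℤ) : height I (c + d) = height I c + height I d :=
  Finset.sum_add_distrib

theorem height_neg (I : Finset ι) (c : ι → ℤ) : height I (-c) = -height I c := by
  simp [height]

theorem height_single [DecidableEq ι] (I : Finset ι) (i : ι) :
    height I (Pi.single i 1) = if i ∈ I then 1 else 0 := by
  simp [height]

end Height

section Gens

variable {ι : Type u} {H : Type v} [Fintype ι] [AddCommGroup H] [Module ℂ H]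
  {A : Matrix ι ι ℤ} {R : Realization A H} {L : Type w} [LieRing L] [LieAlgebra ℂ L]

theorem weight_apply (R : Realization A H) (c : ι → ℤ) (a : H) :
    weight R c a = ∑ i, (c i : ℂ) * R.simpleRoot i a := by
  simp [weight, LinearMap.sum_apply]

theorem weight_add (R : Realization A H) (c d : ι → ℤ) :
    weight R (c + d) = weight R c + weight R d := by
  simp [weight, add_smul, Finset.sum_add_distrib]

theorem weight_neg (R : Realization A H) (c : ι → ℤ) : weight R (-c) = -weight R c := by
  simp [weight]

theorem weight_single [DecidableEq ι] (R : Realization A H) (i : ι) :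
    weight R (Pi.single i 1) = R.simpleRoot i := by
  ext a
  rw [weight_apply, Finset.sum_eq_single i]
  · simp
  · intro j _ hj; simp [hj]
  · simp

/-- There is an element of `𝔥` at which every weight takes its `I`-height as value. -/
theorem Realization.exists_weight_eq_height (R : Realization A H) (I : Finset ι) :
    ∃ a : H, ∀ c, weight R c a = (height I c : ℂ) := by
  classical
  obtain ⟨a, ha⟩ := R.exists_simpleRoot_eq fun i => if i ∈ I then 1 else 0
  refine ⟨a, fun c => ?_⟩
  rw [weight_apply, height]
  simp [ha]

theorem exists_weight_apply_ne_zero (R : Realization A H) {c : ι → ℤ} (hc : c ≠ 0) :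
    ∃ a, weight R c a ≠ 0 := by
  classical
  obtain ⟨i, hi⟩ := Function.ne_iff.1 hc
  obtain ⟨a, ha⟩ := R.exists_weight_eq_height {i}
  refine ⟨a, ?_⟩
  rw [ha]
  simpa [height] using hi

namespace ChevalleyGens

variable (D : ChevalleyGens R L)

/-- `x` has weight `c` with respect to the adjoint action of `𝔥`. -/
def HasWeight (c : ι → ℤ) (x : L) : Prop := ∀ a, x ∈ D.eig a (weight R c a)

theorem HasWeight.lie {D : ChevalleyGens R L} {c d : ι → ℤ} {x y : L} (hx : D.HasWeight c x)
    (hy : D.HasWeight d y) : D.HasWeight (c + d) ⁅x, y⁆ := fun a => by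
  rw [weight_add]
  exact D.lie_mem_eig (hx a) (hy a)

theorem hasWeight_e [DecidableEq ι] (i : ι) : D.HasWeight (Pi.single i 1) (D.e i) := fun a => by
  rw [weight_single]; exact D.e_mem_eig a i

theorem hasWeight_f [DecidableEq ι] (i : ι) : D.HasWeight (-Pi.single i 1) (D.f i) := fun a => by
  rw [weight_neg, weight_single]; exact D.f_mem_eig a i

theorem hasWeight_h (b : H) : D.HasWeight 0 (D.h b) := fun a => by
  rw [weight_apply]; simpa using D.h_mem_eig a b

/-- An ideal containing one `e_i` contains all of them, if `A` is indecomposable. -/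
theorem e_mem_of_e_mem (hA : IsGCM A) (hA' : IsIndecomposable A) {J : LieIdeal ℂ L} {i : ι}
    (hi : D.e i ∈ J) (j : ι) : D.e j ∈ J := by
  by_contra hj
  obtain ⟨k, hk, l, hl, hkl⟩ := hA' {k | D.e k ∈ J} ⟨i, hi⟩ ⟨j, hj⟩
  refine hl ?_
  have hne : A k l ≠ 0 := by
    rcases hkl with h | h
    · exact h
    · exact fun h0 => h (hA.zero_symm _ _ h0)
  -- This bracket equals a_{kl} e_l.
  have h1 : ⁅⁅D.e k, D.f k⁆, D.e l⁆ ∈ J :=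
    lie_mem_left ℂ L J _ _ (lie_mem_left ℂ L J _ _ hk)
  rw [D.e_f_same, D.h_e, R.pairing] at h1
  exact (Submodule.smul_mem_iff J.toSubmodule (Int.cast_ne_zero.2 hne)).1 h1

theorem f_mem_of_e_mem (hA : IsGCM A) {J : LieIdeal ℂ L} {i : ι} (hi : D.e i ∈ J) :
    D.f i ∈ J := by
  have h1 : ⁅⁅D.e i, D.f i⁆, D.f i⁆ ∈ J :=
    lie_mem_left ℂ L J _ _ (lie_mem_left ℂ L J _ _ hi)
  rw [D.e_f_same, D.h_f, R.pairing, hA.diag] at h1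
  exact (Submodule.smul_mem_iff J.toSubmodule (by norm_num : ((2 : ℤ) : ℂ) ≠ 0)).1
    ((Submodule.neg_mem_iff _).1 h1)

/-- An ideal containing all `e_i` and `f_i` contains all eigenvectors of elements of `𝔥` with
nonzero eigenvalue. -/
theorem mem_of_mem_eig {J : LieIdeal ℂ L} (he : ∀ i, D.e i ∈ J) (hf : ∀ i, D.f i ∈ J) {a : H}
    {μ : ℂ} (hμ : μ ≠ 0) {y : L} (hy : y ∈ D.eig a μ) : y ∈ J := by
  -- `J` + 𝔥 is a subalgebra containing the generators, so y = u + h with u in `J`; then μ y = ⁅h_a,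
  -- y⁆ = ⁅h_a, u⁆ lies in `J`.
  let K : LieSubalgebra ℂ L :=
    { J.toSubmodule ⊔ LinearMap.range D.h with
      lie_mem' := by
        intro x z hx hz
        obtain ⟨u, hu, _, ⟨b, rfl⟩, rfl⟩ := Submodule.mem_sup.1 hx
        obtain ⟨v, hv, _, ⟨c, rfl⟩, rfl⟩ := Submodule.mem_sup.1 hz
        refine Submodule.mem_sup_left ?_
        rw [lie_add, add_lie, add_lie, D.h_h, add_zero]
        exact J.add_mem (J.add_mem (J.lie_mem hv) (J.lie_mem hv)) (lie_mem_left ℂ L J _ _ hu) }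
  have hK : K = ⊤ := D.eq_top K (fun i => Submodule.mem_sup_left (he i))
    (fun i => Submodule.mem_sup_left (hf i)) fun b => Submodule.mem_sup_right ⟨b, rfl⟩
  have hyK : y ∈ K := by rw [hK]; trivial
  obtain ⟨u, hu, _, ⟨b, rfl⟩, rfl⟩ := Submodule.mem_sup.1 hyK
  have h1 : ⁅D.h a, u⁆ ∈ J := J.lie_mem hu
  rw [mem_eig, lie_add, D.h_h, add_zero] at hy
  rw [hy] at h1
  exact (Submodule.smul_mem_iff J.toSubmodule hμ).1 h1

variable (hD : ∀ J : LieIdeal ℂ L, (∀ x ∈ J, x ∈ LinearMap.range D.h → x = 0) → J = ⊥)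

include hD

/-- A vector of positive principal degree that commutes with all `f_i` vanishes. -/
theorem exists_f_lie_ne_zero {ρ : H} (hρ : ∀ i, R.simpleRoot i ρ = 1) {k : ℕ} {x : L}
    (hx : x ∈ D.eig ρ ((k + 1 : ℕ) : ℂ)) (hx0 : x ≠ 0) : ∃ i, ⁅D.f i, x⁆ ≠ 0 := by
  by_contra! hcon
  set S₀ : Set L := Set.range D.h
  set S₁ : Set L := Set.range D.f
  -- Scalar multiples are included so that bracketing with 𝔥 preserves `T`.
  set T : Set L := {z | ∃ (c : ℂ) (i : ι), z = c • D.e i}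
  set M : Submodule ℂ L := D.eig ρ ((k + 1 : ℕ) : ℂ) ⊓ transporter S₁ ⊥
  have hst : S₀ ∪ S₁ ∪ T ⊆ stabilizer (adClosure T M) := by
    refine le_stabilizer_adClosure ?_ ?_ ?_ ?_
    · rintro _ ⟨a, rfl⟩ z ⟨hz, hz'⟩
      refine ⟨?_, ?_⟩
      · have := D.lie_mem_eig (D.h_mem_eig ρ a) hz
        rwa [zero_add] at this
      · rintro _ ⟨i, rfl⟩
        have h0 : ⁅D.f i, z⁆ = 0 := hz' _ ⟨i, rfl⟩
        rw [leibniz_lie, D.f_h, smul_lie, h0, smul_zero, lie_zero, add_zero]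
        exact Submodule.zero_mem _
    · rintro y hy z ⟨-, hz⟩
      exact hz y hy
    · rintro _ ⟨a, rfl⟩ _ ⟨c, i, rfl⟩
      exact ⟨c * R.simpleRoot i a, i, by rw [lie_smul, D.h_e, smul_smul]⟩
    · rintro _ ⟨j, rfl⟩ _ ⟨c, i, rfl⟩
      rw [lie_smul]
      exact (LinearMap.range D.h).smul_mem c (D.f_e_mem_range j i)
  have htop : stabilizer (adClosure T M) = ⊤ := D.eq_top _
    (fun i => hst (Or.inr ⟨1, i, (one_smul _ _).symm⟩))
    (fun i => hst (Or.inl (Or.inr ⟨i, rfl⟩))) fun a => hst (Or.inl (Or.inl ⟨a, rfl⟩))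
  -- Each e_i raises the degree by one, so the closure avoids degree zero, where 𝔥 sits.
  have hle : adClosure T M ≤ ⨆ μ ∈ Set.range fun n : ℕ => ((n + 1 : ℕ) : ℂ), D.eig ρ μ := by
    refine adClosure_le (inf_le_left.trans (le_iSup₂_of_le _ ⟨k, rfl⟩ le_rfl)) ?_
    rintro z hz _ ⟨c, i, rfl⟩
    rw [smul_lie]
    refine Submodule.smul_mem _ _ ?_
    rw [← LieAlgebra.ad_apply (R := ℂ), ← Submodule.mem_comap]
    refine (iSup₂_le ?_ : _ ≤ Submodule.comap (LieAlgebra.ad ℂ L (D.e i)) _) hz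
    clear z hz
    rintro _ ⟨n, rfl⟩ z hz
    refine Submodule.mem_iSup_of_mem _ (Submodule.mem_iSup_of_mem ⟨n + 1, rfl⟩ ?_)
    have := D.lie_mem_eig (D.e_mem_eig ρ i) hz
    rwa [hρ, add_comm, ← Nat.cast_succ] at this
  have hbot := hD (idealOfStable _ htop) (by
    rintro _ hz ⟨a, rfl⟩
    refine D.eq_zero_of_mem_eig ?_ (D.h_mem_eig ρ a) (hle hz)
    rintro ⟨n, hn⟩
    exact n.succ_ne_zero (Nat.cast_eq_zero.1 hn))
  have hxJ : x ∈ idealOfStable _ htop := by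
    refine le_adClosure T M ⟨hx, ?_⟩
    rintro _ ⟨i, rfl⟩
    rw [hcon i]; exact Submodule.zero_mem _
  rw [hbot] at hxJ
  exact hx0 ((LieSubmodule.mem_bot x).1 hxJ)

/-- Some f_i lowers the degree without killing the vector. In degree one the vector is a combination
of the e_i, whose terms 𝔥 separates. -/
theorem exists_e_mem {ρ : H} (hρ : ∀ i, R.simpleRoot i ρ = 1) (J : LieIdeal ℂ L) (k : ℕ) :
    ∀ x ∈ J, x ∈ D.eig ρ ((k + 1 : ℕ) : ℂ) → x ≠ 0 → ∃ i, D.e i ∈ J := by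
  classical
  induction k with
  | zero =>
    intro x hxJ hx hx0
    obtain ⟨c, rfl⟩ := (Submodule.mem_span_range_iff_exists_fun ℂ).1
      (D.posPart_one_le (D.eig_natCast_le hρ 1 hx))
    obtain ⟨i, hi⟩ : ∃ i, c i ≠ 0 := by
      by_contra! h
      exact hx0 (Finset.sum_eq_zero fun i _ => by rw [h i, zero_smul])
    obtain ⟨a, ha⟩ := R.exists_simpleRoot_eq fun j => if j = i then 1 else 0
    refine ⟨i, ?_⟩
    have h1 : ⁅D.h a, ∑ j, c j • D.e j⁆ = c i • D.e i := by
      rw [lie_sum, Finset.sum_eq_single i]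
      · rw [lie_smul, D.h_e, ha, if_pos rfl, one_smul]
      · intro j _ hj
        rw [lie_smul, D.h_e, ha, if_neg hj, zero_smul, smul_zero]
      · simp
    have h2 : c i • D.e i ∈ J := h1 ▸ J.lie_mem hxJ
    exact (Submodule.smul_mem_iff J.toSubmodule hi).1 h2
  | succ k ih =>
    intro x hxJ hx hx0
    obtain ⟨i, hi⟩ := D.exists_f_lie_ne_zero hD hρ hx hx0
    refine ih _ (J.lie_mem hxJ) ?_ hi
    have := D.lie_mem_eig (D.f_mem_eig ρ i) hx
    rwa [hρ, show (-1 + ((k + 1 + 1 : ℕ) : ℂ)) = ((k + 1 : ℕ) : ℂ) by push_cast; ring] at this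

/-- If a nonzero vector of positive weight `β` commutes with all vectors of `I`-height one, then no
root has larger `I`-height than `β`. -/
theorem height_le_of_forall_lie_eq_zero (hA : IsGCM A) (hA' : IsIndecomposable A) (I : Finset ι)
    {β : ι → ℤ} (hβ : ∀ i, 0 ≤ β i) (hβ0 : β ≠ 0) {x : L} (hx : D.HasWeight β x) (hx0 : x ≠ 0)
    (hlie : ∀ γ y, height I γ = 1 → D.HasWeight γ y → ⁅y, x⁆ = 0)
    {α : ι → ℤ} (hα0 : α ≠ 0) {y : L} (hy : D.HasWeight α y) (hy0 : y ≠ 0) :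
    height I α ≤ height I β := by
  classical
  obtain ⟨a, ha⟩ := R.exists_weight_eq_height I
  let S : ℤ → Set L := fun n => {z | ∃ c, height I c = n ∧ D.HasWeight c z}
  have hS : ∀ {m n : ℤ} {z w : L}, z ∈ S m → w ∈ S n → ⁅z, w⁆ ∈ S (m + n) := by
    rintro m n z w ⟨c, rfl, hz⟩ ⟨d, rfl, hw⟩
    exact ⟨c + d, height_add I c d, hz.lie hw⟩
  have hSeig : ∀ {n : ℤ} {z : L}, z ∈ S n → z ∈ D.eig a (n : ℂ) := by
    rintro n z ⟨c, rfl, hz⟩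
    rw [← ha]
    exact hz a
  set M : Submodule ℂ L := D.eig a (height I β : ℂ) ⊓ transporter (S 1) ⊥
  have hst : S 0 ∪ S 1 ∪ S (-1) ⊆ stabilizer (adClosure (S (-1)) M) := by
    refine le_stabilizer_adClosure ?_ ?_ (fun y hy t ht => hS hy ht) fun y hy t ht => hS hy ht
    · rintro w hw z ⟨hz, hz'⟩
      refine ⟨?_, fun v hv => ?_⟩
      · have := D.lie_mem_eig (hSeig hw) hz
        rwa [Int.cast_zero, zero_add] at this
      · have h1 : ⁅⁅v, w⁆, z⁆ = 0 := hz' _ (hS hv hw)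
        have h2 : ⁅v, z⁆ = 0 := hz' _ hv
        rw [leibniz_lie, h1, h2, lie_zero, add_zero]
        exact Submodule.zero_mem _
    · rintro w hw z ⟨-, hz⟩
      exact hz w hw
  have htop : stabilizer (adClosure (S (-1)) M) = ⊤ := by
    refine D.eq_top _ (fun i => hst ?_) (fun i => hst ?_) fun b => hst ?_
    · by_cases hi : i ∈ I
      · exact Or.inl (Or.inr ⟨_, by rw [height_single, if_pos hi], D.hasWeight_e i⟩)
      · exact Or.inl (Or.inl ⟨_, by rw [height_single, if_neg hi], D.hasWeight_e i⟩)
    · by_cases hi : i ∈ I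
      · exact Or.inr ⟨_, by rw [height_neg, height_single, if_pos hi], D.hasWeight_f i⟩
      · exact Or.inl (Or.inl ⟨_, by rw [height_neg, height_single, if_neg hi, neg_zero],
          D.hasWeight_f i⟩)
    · exact Or.inl (Or.inl ⟨0, by simp [height], D.hasWeight_h b⟩)
  have hle : adClosure (S (-1)) M ≤
      ⨆ μ ∈ (Int.cast : ℤ → ℂ) '' Set.Iic (height I β), D.eig a μ := by
    refine adClosure_le (inf_le_left.trans (le_iSup₂_of_le _ ⟨_, Set.self_mem_Iic, rfl⟩ le_rfl)) ?_
    intro z hz t ht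
    rw [← LieAlgebra.ad_apply (R := ℂ), ← Submodule.mem_comap]
    refine (iSup₂_le ?_ : _ ≤ Submodule.comap (LieAlgebra.ad ℂ L t) _) hz
    clear z hz
    rintro _ ⟨n, hn, rfl⟩ z hz
    refine Submodule.mem_iSup_of_mem ((-1 + n : ℤ) : ℂ)
      (Submodule.mem_iSup_of_mem ⟨-1 + n, ?_, rfl⟩ ?_)
    · have : n ≤ height I β := hn
      exact Set.mem_Iic.2 (by omega)
    · have := D.lie_mem_eig (hSeig ht) hz
      rwa [← Int.cast_add] at this
  set J := idealOfStable _ htop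
  have hxJ : x ∈ J := by
    refine le_adClosure _ _ ⟨hSeig ⟨β, rfl, hx⟩, ?_⟩
    rintro w ⟨γ, hγ, hw⟩
    rw [hlie γ w hγ hw]; exact Submodule.zero_mem _
  -- The height over all indices is the principal degree; it is positive at β even when ht_I(β) = 0.
  obtain ⟨ρ, hρ⟩ := R.exists_weight_eq_height (Finset.univ : Finset ι)
  have hρ' : ∀ i, R.simpleRoot i ρ = 1 := fun i => by
    rw [← weight_single, hρ, height_single]; simp
  have hpos : 0 < height Finset.univ β := by
    obtain ⟨i, hi⟩ := Function.ne_iff.1 hβ0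
    exact Finset.sum_pos' (fun i _ => hβ i)
      ⟨i, Finset.mem_univ i, lt_of_le_of_ne (hβ i) (Ne.symm hi)⟩
  obtain ⟨k, hk⟩ : ∃ k : ℕ, height Finset.univ β = ((k + 1 : ℕ) : ℤ) :=
    ⟨(height Finset.univ β).toNat - 1, by omega⟩
  obtain ⟨i, hi⟩ := D.exists_e_mem hD hρ' J k x hxJ
    (by have := hx ρ; rwa [hρ, hk, Int.cast_natCast] at this) hx0
  have he := D.e_mem_of_e_mem hA hA' hi
  obtain ⟨b, hb⟩ := exists_weight_apply_ne_zero R hα0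
  have hyJ : y ∈ J := D.mem_of_mem_eig he (fun j => D.f_mem_of_e_mem hA (he j)) hb (hy b)
  by_contra hlt
  refine hy0 (D.eq_zero_of_mem_eig ?_ (hSeig ⟨α, rfl, hy⟩) (hle hyJ))
  rintro ⟨n, hn, hn'⟩
  have := Int.cast_injective hn'
  subst this
  exact hlt hn

end ChevalleyGens

end Gens

/-! ### Transfer to 𝔤̃(A) and 𝔤(A) -/

section

variable {ι : Type u} {H : Type v} [Fintype ι] [AddCommGroup H] [Module ℂ H]
  {A : Matrix ι ι ℤ} (R : Realization A H)

theorem eq_top_of_freeLieAlgebra_of_mem {X : Type*} (K : LieSubalgebra ℂ (FreeLieAlgebra ℂ X))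
    (hK : ∀ x, FreeLieAlgebra.of ℂ x ∈ K) : K = ⊤ := by
  have h : K.incl.comp (FreeLieAlgebra.lift ℂ fun x => (⟨FreeLieAlgebra.of ℂ x, hK x⟩ : K)) =
      LieHom.id := by
    refine FreeLieAlgebra.hom_ext fun x => ?_
    rw [LieHom.comp_apply, FreeLieAlgebra.lift_of_apply]
    rfl
  rw [eq_top_iff]
  intro x _
  have hx := LieHom.congr_fun h x
  rw [LieHom.comp_apply] at hx
  rw [← LieHom.id_apply (R := ℂ) x, ← hx]
  exact Subtype.mem _

variable {L : Type*} [LieRing L] [LieAlgebra ℂ L]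

/-- A surjective homomorphism from the free Lie algebra that respects the defining relations
gives Chevalley generators of its codomain. -/
def ChevalleyGens.ofSurjective (φ : Free ι H →ₗ⁅ℂ⁆ L) (hφ : Function.Surjective φ)
    (hrel : ∀ x, Rel R x → φ x = 0) : ChevalleyGens R L where
  e := fun i => φ (freeE H i)
  f := fun i => φ (freeF H i)
  h :=
    { toFun := fun a => φ (freeH ι a)
      map_add' := fun a b => by
        have := hrel _ (Rel.add a b)
        rwa [map_sub, sub_eq_zero, map_add] at this
      map_smul' := fun c a => by
        have := hrel _ (Rel.smul c a)
        rwa [map_sub, sub_eq_zero, map_smul] at this }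
  h_h := fun a b => by
    have := hrel _ (Rel.hh a b)
    rwa [LieHom.map_lie] at this
  e_f_same := fun i => by
    have := hrel _ (Rel.ef_same i)
    rwa [map_sub, sub_eq_zero, LieHom.map_lie] at this
  e_f_ne := fun i j hij => by
    have := hrel _ (Rel.ef_ne i j hij)
    rwa [LieHom.map_lie] at this
  h_e := fun a i => by
    have := hrel _ (Rel.he a i)
    rwa [map_sub, sub_eq_zero, LieHom.map_lie, map_smul] at this
  h_f := fun a i => by
    have := hrel _ (Rel.hf a i)
    rwa [map_add, add_eq_zero_iff_eq_neg, LieHom.map_lie, map_smul] at this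
  eq_top := fun K he hf hh => by
    have h := eq_top_of_freeLieAlgebra_of_mem (K.comap φ) fun x => by
      cases x with
      | e i => exact he i
      | f i => exact hf i
      | h a => exact hh a
    rw [eq_top_iff]
    intro y _
    obtain ⟨x, rfl⟩ := hφ y
    have hx : x ∈ K.comap φ := by rw [h]; trivial
    exact hx

/-- The quotient map onto a quotient Lie algebra. -/
def quotientHom (J : LieIdeal ℂ L) : L →ₗ⁅ℂ⁆ L ⧸ J :=
  { J.toSubmodule.mkQ with map_lie' := fun {_ _} => rfl }

theorem quotientHom_surjective (J : LieIdeal ℂ L) : Function.Surjective (quotientHom J) :=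
  Submodule.mkQ_surjective _

theorem quotientHom_eq_zero {J : LieIdeal ℂ L} {x : L} : quotientHom J x = 0 ↔ x ∈ J :=
  LieSubmodule.Quotient.mk_eq_zero'

theorem quotientHom_relIdeal_eq_zero {x : Free ι H} (hx : Rel R x) :
    quotientHom (relIdeal R) x = 0 :=
  quotientHom_eq_zero.2 (LieSubmodule.subset_lieSpan hx)

/-- The Chevalley generators of `𝔤̃(A)`. -/
def auxGens : ChevalleyGens R (AuxAlgebra R) :=
  .ofSurjective R (quotientHom (relIdeal R)) (quotientHom_surjective _) fun _ hx =>
    quotientHom_relIdeal_eq_zero R hx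

/-- The Chevalley generators of `𝔤(A)`. -/
def kmGens : ChevalleyGens R (KMAlgebra R) :=
  .ofSurjective R ((quotientHom (radical R)).comp (quotientHom (relIdeal R)))
    ((quotientHom_surjective _).comp (quotientHom_surjective _)) fun x hx => by
      rw [LieHom.comp_apply, quotientHom_relIdeal_eq_zero R hx, map_zero]

theorem mem_rootSpace_iff {β : ι → ℤ} {x : KMAlgebra R} :
    x ∈ rootSpace R β ↔ (kmGens R).HasWeight β x :=
  forall_congr' fun _ => (kmGens R).mem_eig.symm

theorem eq_zero_of_mem_radical {x : AuxAlgebra R} (hx : x ∈ radical R) (hx' : x ∈ auxCartan R) :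
    x = 0 :=
  (auxGens R).eq_zero_of_mem_sSup hx hx'

/-- Every nonzero ideal of `𝔤(A)` intersects `𝔥` nontrivially. -/
theorem kmAlgebra_ideal_eq_bot (J : LieIdeal ℂ (KMAlgebra R))
    (hJ : ∀ x ∈ J, x ∈ LinearMap.range (kmGens R).h → x = 0) : J = ⊥ := by
  -- An element of 𝔥 in the preimage maps into `J` ∩ 𝔥 = 0, so it lies in the radical, which itself
  -- misses 𝔥.
  have hle : J.comap (quotientHom (radical R)) ≤ radical R := by
    refine le_sSup ?_
    rintro _ hx ⟨a, rfl⟩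
    refine eq_zero_of_mem_radical R (quotientHom_eq_zero.1 (hJ _ ?_ ⟨a, rfl⟩)) ⟨a, rfl⟩
    exact LieIdeal.mem_comap.1 hx
  rw [eq_bot_iff]
  intro x hx
  obtain ⟨y, rfl⟩ := quotientHom_surjective _ x
  exact (LieSubmodule.mem_bot _).2 (quotientHom_eq_zero.2 (hle (LieIdeal.mem_comap.2 hx)))

end

end

end KacMoody

/-! ### The theorem -/

theorem theorem3p6 {ι : Type*} [Fintype ι]
    {H : Type*} [AddCommGroup H] [Module ℂ H]
    (A : Matrix ι ι ℤ) (hA : KacMoody.IsGCM A) (hA' : KacMoody.IsIndecomposable A)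
    (R : KacMoody.Realization A H) (I : Finset ι) (hI : I.Nonempty)
    (β : ι → ℤ) (hβ : β ∈ KacMoody.positiveRoots R)
    (hβI : ((KacMoody.height I β : ℝ) : EReal) <
      ⨆ α ∈ KacMoody.roots R, ((KacMoody.height I α : ℝ) : EReal))
    (x : KacMoody.KMAlgebra R) (hx : x ∈ KacMoody.rootSpace R β) (hx0 : x ≠ 0) :
    ∃ γ ∈ KacMoody.rootsOfHeight R I 1,
      (∃ y ∈ KacMoody.rootSpace R γ, y ≠ 0 ∧ ⁅y, x⁆ ≠ 0) ∧ β + γ ∈ KacMoody.roots R := by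
  obtain ⟨⟨hβ0, -⟩, hβpos⟩ := hβ
  obtain ⟨γ, y, hγ, hy, hyx⟩ : ∃ γ y, KacMoody.height I γ = 1 ∧
      (KacMoody.kmGens R).HasWeight γ y ∧ ⁅y, x⁆ ≠ 0 := by
    by_contra! hcon
    refine absurd hβI (not_lt.2 (iSup₂_le ?_))
    rintro α ⟨hα0, hα⟩
    obtain ⟨z, hz, hz0⟩ := (Submodule.ne_bot_iff _).1 hα
    have := (KacMoody.kmGens R).height_le_of_forall_lie_eq_zero
      (KacMoody.kmAlgebra_ideal_eq_bot R) hA hA' I hβpos hβ0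
      ((KacMoody.mem_rootSpace_iff R).1 hx) hx0 hcon hα0 ((KacMoody.mem_rootSpace_iff R).1 hz) hz0
    exact_mod_cast this
  have hht : 0 ≤ KacMoody.height I β := Finset.sum_nonneg fun i _ => hβpos i
  have hy0 : y ≠ 0 := by rintro rfl; exact hyx (zero_lie x)
  have hyγ := (KacMoody.mem_rootSpace_iff R).2 hy
  have hmem : ⁅y, x⁆ ∈ KacMoody.rootSpace R (β + γ) := by
    rw [KacMoody.mem_rootSpace_iff, add_comm]
    exact hy.lie ((KacMoody.mem_rootSpace_iff R).1 hx)
  refine ⟨γ, ⟨⟨?_, (Submodule.ne_bot_iff _).2 ⟨y, hyγ, hy0⟩⟩, hγ⟩, ⟨y, hyγ, hy0, hyx⟩, ?_,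
    (Submodule.ne_bot_iff _).2 ⟨_, hmem, hyx⟩⟩
  · rintro rfl
    simp [KacMoody.height] at hγ
  -- β + γ ≠ 0 because its `I`-height is ht_I(β) + 1 ≥ 1.
  · intro h0
    have h1 := KacMoody.height_add I β γ
    rw [h0, hγ] at h1
    simp only [KacMoody.height, Pi.zero_apply, Finset.sum_const_zero] at h1 hht
    omega
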